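/- Let $\mathscr H$ be a complex separable Hilbert space with identity operator $I$, and let $0\le\mu\le1$. For positive invertible bounded operators $X,Y$ on $\mathscr H$ put $$X\nabla_\mu Y=(1-\mu)X+\mu Y,\qquad X\sharp_\mu Y=X^{1/2}\big(X^{-1/2}YX^{-1/2}\big)^{\mu}X^{1/2},\qquad X!_\mu Y=\big((1-\mu)X^{-1}+\mu Y^{-1}\big)^{-1}.$$ For a compact positive operator $T$ let $\lambda_1(T)\ge\lambda_2(T)\ge\cdots\ge0$ be its eigenvalues arranged in decreasing order and repeated according to multiplicity (with $\lambda_j(T)=0$ when $T$ has fewer than $j$ positive eigenvalues, counted with multiplicity). Let $A,B$ be positive invertible bounded operators on $\mathscr H$ with $A\le\frac12I$, $B\le\frac12I$ and $A-B$ compact, and put $A'=I-A$, $B'=I-B$. Then the operators $(A\sharp_\mu B)^{-1}-(A\nabla_\mu B)^{-1}$, $(A!_\mu B)^{-1}-(A\sharp_\mu B)^{-1}$, $(A!_\mu B)^{-1}-(A\nabla_\mu B)^{-1}$ and the same operators formed from $A',B'$ are positive and compact, and for all $j=1,2,\ldots$ $$\lambda_j\big((A'\sharp_\mu B')^{-1}-(A'\nabla_\mu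 B')^{-1}\big)\le\lambda_j\big((A\sharp_\mu B)^{-1}-(A\nabla_\mu B)^{-1}\big),$$ $$\lambda_j\big((A'!_\mu B')^{-1}-(A'\sharp_\mu B')^{-1}\big)\le\lambda_j\big((A!_\mu B)^{-1}-(A\sharp_\mu B)^{-1}\big),$$ $$\lambda_j\big((A'!_\mu B')^{-1}-(A'\nabla_\mu B')^{-1}\big)\le\lambda_j\big((A!_\mu B)^{-1}-(A\nabla_\mu B)^{-1}\big).$$ Moreover, when $0<\mu<1$, for each of these three systems of inequalities, equality holds for all $j$ if and only if $A=B$. -/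

import Mathlib

section OperatorMeans

variable {H : Type*} [NormedAddCommGroup H] [InnerProductSpace ℂ H] [CompleteSpace H]

/-- The weighted arithmetic mean `A ∇_μ B = (1 - μ) A + μ B`. -/
noncomputable def arithMean (μ : ℝ) (A B : H →L[ℂ] H) : H →L[ℂ] H :=
  (1 - μ) • A + μ • B

/-- The weighted geometric mean `A ♯_μ B = A^{1/2} (A^{-1/2} B A^{-1/2})^μ A^{1/2}` of positive
invertible operators; the real powers are those of the continuous functional calculus. -/
noncomputable def geomMean (μ : ℝ) (A B : H →L[ℂ] H) : H →L[ℂ] H :=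
  A ^ (1 / 2 : ℝ) * (A ^ (-(1 / 2) : ℝ) * B * A ^ (-(1 / 2) : ℝ)) ^ μ * A ^ (1 / 2 : ℝ)

/-- The weighted harmonic mean `A !_μ B = ((1 - μ) A⁻¹ + μ B⁻¹)⁻¹` of positive invertible
operators; `Ring.inverse` is the inverse of an invertible operator. -/
noncomputable def harmMean (μ : ℝ) (A B : H →L[ℂ] H) : H →L[ℂ] H :=
  Ring.inverse ((1 - μ) • Ring.inverse A + μ • Ring.inverse B)

end OperatorMeans

section Eigenvalues

variable {H : Type*} [NormedAddCommGroup H] [InnerProductSpace ℂ H]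

/-- The number of eigenvalues `s ≥ t` of `T`, counted with multiplicity: the dimension of the span
of the eigenspaces of `T` at the real numbers `s ≥ t`. (For a self-adjoint operator these
eigenspaces are mutually orthogonal, so this is the sum of the multiplicities.) It is finite if `T`
is compact and positive and `t > 0`. -/
noncomputable def eigenvalueCount (T : H →L[ℂ] H) (t : ℝ) : Cardinal :=
  Module.rank ℂ
    (⨆ s ∈ Set.Ici t, Module.End.eigenspace (T : H →ₗ[ℂ] H) (s : ℂ) : Submodule ℂ H)

/-- The `j`-th eigenvalue `λ_j(T)`, `j = 1, 2, …`, of a compact positive operator `T`, the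
eigenvalues being arranged in decreasing order and repeated according to multiplicity: the largest
`t > 0` such that at least `j` eigenvalues, counted with multiplicity, are `≥ t`. If there are fewer
than `j` positive eigenvalues, then the set is empty and `λ_j(T) = sSup ∅ = 0`. -/
noncomputable def orderedEigenvalue (T : H →L[ℂ] H) (j : ℕ) : ℝ :=
  sSup {t : ℝ | 0 < t ∧ (j : Cardinal) ≤ eigenvalueCount T t}

end Eigenvalues

/-!
Put `C = A^{-1/2} B A^{-1/2}` and `D = B - A`. Each of the differences of inverse means is an
operator `A^{-1/2} f(C) A^{-1/2}`, where `f` is `t^{-μ} - (1 - μ + μ t)⁻¹`,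
`1 - μ + μ / t - t^{-μ}`, or the sum of the two. The eigenvalues at `A, B` and at `A', B'` are
compared through the one operator that the two pairs share up to sign, namely `D`.

The scalar input is a sandwich (`CubicallySandwiched`): with `c = μ (1 - μ) / 2`, or twice that for
the sum, and a weight `0 < s < 1` that depends on `f` and `μ`,
`c (t - 1)² / (1 - s + s t)³ ≤ f(t) ≤ c (t - 1)² (1 - s + s / t)³` for `t > 0`.
It comes from comparing `t^{-μ}` with rational functions that agree with it to third order at `1`
(`le_rpow_mul_of_sign_deriv`), followed by the inequality of the means for three factors.

Inserting `C`, and writing `M = (1 - s) A + s B` and `W = (1 - s) A⁻¹ + s B⁻¹`, gives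
`c M⁻¹ D M⁻¹ D M⁻¹ ≤ A^{-1/2} f(C) A^{-1/2} ≤ c W D W D W` (`invPerspective_cube`). If `A, B ≤ 1/2`,
then `M ≤ 1/2`, so the quadratic form of the middle operator at `M v` is at least `2 c ‖D v‖²`
(`le_reApplyInnerSelf_invPerspective`). For the operators `A', B' ≥ 1/2` the corresponding `W'` is
at most `2`, so the form at `x` is at most `2 c ‖D W' x‖²` (`reApplyInnerSelf_invPerspective_le`).
Hence the injective contraction `M W'` carries a subspace on which the form at `A', B'` is at least `t` to
one on which the form at `A, B` is at least `t`, and the min-max principle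
(`natCast_le_eigenvalueCount_iff`) compares the eigenvalues.

If all eigenvalues agree, the first ones do, and these are the norms. For an eigenvector `v` of the
norm at `A', B'` every inequality above is an equality, so `‖W' v‖ = 2 ‖v‖`; by strict convexity
`A'⁻¹ v = B'⁻¹ v`, hence `D W' v = 0`, and the norm vanishes. The lower bound then forces `D = 0`.

Compactness holds since `f(1) = 0` makes `f(C)` a multiple of `C - 1 = A^{-1/2} D A^{-1/2}`.
-/

/-! ### Scalar inequalities -/

/-- If `t ↦ t ^ μ * R t` decreases on `(0, 1]` and increases on `[1, ∞)`, which is the sign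
condition below on its logarithmic derivative, then it is smallest at `1`. -/
lemma le_rpow_mul_of_sign_deriv {μ : ℝ} {R R' : ℝ → ℝ}
    (hR : ∀ t, 0 < t → HasDerivAt R (R' t) t)
    (hsign : ∀ t, 0 < t → 0 ≤ (t - 1) * (μ * R t + t * R' t)) {t : ℝ} (ht : 0 < t) :
    R 1 ≤ t ^ μ * R t := by
  have hd : ∀ x, 0 < x → HasDerivAt (fun x => x ^ μ * R x)
      (x ^ (μ - 1) * (μ * R x + x * R' x)) x := by
    intro x hx
    have h := (Real.hasDerivAt_rpow_const (p := μ) (Or.inl hx.ne')).mul (hR x hx)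
    refine h.congr_deriv ?_
    have hx' : x ^ μ = x ^ (μ - 1) * x := by
      rw [← Real.rpow_add_one hx.ne', sub_add_cancel]
    rw [hx']; ring
  rcases le_total 1 t with h1 | h1
  · have := monotoneOn_of_deriv_nonneg (f := fun x => x ^ μ * R x) (convex_Icc 1 t)
      (fun x hx => (hd x (by linarith [hx.1])).continuousAt.continuousWithinAt)
      (fun x hx => by
        rw [interior_Icc] at hx
        exact (hd x (by linarith [hx.1])).differentiableAt.differentiableWithinAt)
      (fun x hx => by
        rw [interior_Icc] at hx
        have hx0 : 0 < x := by linarith [hx.1]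
        rw [(hd x hx0).deriv]
        exact mul_nonneg (Real.rpow_nonneg hx0.le _)
          (nonneg_of_mul_nonneg_right (hsign x hx0) (by linarith [hx.1])))
      (Set.left_mem_Icc.2 h1) (Set.right_mem_Icc.2 h1) h1
    simpa using this
  · have := antitoneOn_of_deriv_nonpos (f := fun x => x ^ μ * R x) (convex_Icc t 1)
      (fun x hx => (hd x (by linarith [hx.1])).continuousAt.continuousWithinAt)
      (fun x hx => by
        rw [interior_Icc] at hx
        exact (hd x (by linarith [hx.1])).differentiableAt.differentiableWithinAt)
      (fun x hx => by
        rw [interior_Icc] at hx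
        have hx0 : 0 < x := by linarith [hx.1]
        rw [(hd x hx0).deriv]
        refine mul_nonpos_of_nonneg_of_nonpos (Real.rpow_nonneg hx0.le _) ?_
        by_contra! hcon
        have := hsign x hx0
        nlinarith [hx.2])
      (Set.left_mem_Icc.2 h1) (Set.right_mem_Icc.2 h1) h1
    simpa using this

lemma hasDerivAt_div_of_pos {N N' D D' : ℝ → ℝ}
    (hN : ∀ t, HasDerivAt N (N' t) t) (hD : ∀ t, HasDerivAt D (D' t) t)
    {t : ℝ} (hpos : 0 < D t) :
    HasDerivAt (fun t => N t / D t) ((N' t * D t - N t * D' t) / D t ^ 2) t :=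
  (hN t).div (hD t) hpos.ne'

/-- An upper bound for a negative power by a quotient `N / D`; the sign condition is that of
`le_rpow_mul_of_sign_deriv`, cleared of denominators. -/
lemma rpow_neg_le_div_of_sign {μ : ℝ} {N N' D D' : ℝ → ℝ}
    (hN : ∀ t, HasDerivAt N (N' t) t) (hD : ∀ t, HasDerivAt D (D' t) t)
    (hpos : ∀ t, 0 < t → 0 < D t) (h1 : N 1 / D 1 = 1)
    (hsign : ∀ t, 0 < t → 0 ≤ (t - 1) * (μ * N t * D t + t * (N' t * D t - N t * D' t)))
    {t : ℝ} (ht : 0 < t) : t ^ (-μ) ≤ N t / D t := by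
  have h := le_rpow_mul_of_sign_deriv (μ := μ) (R := fun t => N t / D t)
    (fun t ht => hasDerivAt_div_of_pos hN hD (hpos t ht)) (fun t ht => ?_) ht
  · have hp : 0 < t ^ μ := Real.rpow_pos_of_pos ht μ
    rw [Real.rpow_neg ht.le, inv_le_iff_one_le_mul₀ hp, ← h1, mul_comm]
    exact h
  · have hD0 := hpos t ht
    have h := div_nonneg (hsign t ht) (sq_nonneg (D t))
    refine h.trans_eq ?_
    field_simp

/-- A lower bound for a negative power by a quotient `N / D`; the sign condition is opposite to
that of `rpow_neg_le_div_of_sign`. -/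
lemma div_le_rpow_neg_of_sign {μ : ℝ} {N N' D D' : ℝ → ℝ}
    (hN : ∀ t, HasDerivAt N (N' t) t) (hD : ∀ t, HasDerivAt D (D' t) t)
    (hpos : ∀ t, 0 < t → 0 < D t) (h1 : N 1 / D 1 = 1)
    (hsign : ∀ t, 0 < t → (t - 1) * (μ * N t * D t + t * (N' t * D t - N t * D' t)) ≤ 0)
    {t : ℝ} (ht : 0 < t) : N t / D t ≤ t ^ (-μ) := by
  have h := le_rpow_mul_of_sign_deriv (μ := μ) (R := fun t => -(N t / D t))
    (fun t ht => (hasDerivAt_div_of_pos hN hD (hpos t ht)).neg) (fun t ht => ?_) ht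
  · have hp : 0 < t ^ μ := Real.rpow_pos_of_pos ht μ
    rw [Real.rpow_neg ht.le, ← one_div, le_div_iff₀ hp]
    linarith
  · have hD0 := hpos t ht
    have h := div_nonneg (neg_nonneg.2 (hsign t ht)) (sq_nonneg (D t))
    refine h.trans_eq ?_
    field_simp
    ring

lemma one_sub_add_mul_pos {s t : ℝ} (hs₀ : 0 ≤ s) (hs₁ : s ≤ 1) (ht : 0 < t) :
    0 < 1 - s + s * t := by
  rcases hs₁.lt_or_eq with h | rfl
  · have := mul_nonneg hs₀ ht.le
    linarith
  · simpa using ht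

/-- The inequality between the arithmetic and geometric means of three numbers. -/
lemma mul_mul_le_mean_pow_three {x y z : ℝ} (hx : 0 ≤ x) (hy : 0 ≤ y) (hz : 0 ≤ z) :
    x * y * z ≤ ((x + y + z) / 3) ^ 3 := by
  nlinarith [mul_nonneg hx (sq_nonneg (y - z)), mul_nonneg hy (sq_nonneg (x - z)),
    mul_nonneg hz (sq_nonneg (x - y)), mul_nonneg hx (sq_nonneg (x - y)),
    mul_nonneg hx (sq_nonneg (x - z)), mul_nonneg hy (sq_nonneg (y - x)),
    mul_nonneg hy (sq_nonneg (y - z)), mul_nonneg hz (sq_nonneg (z - x)),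
    mul_nonneg hz (sq_nonneg (z - y))]

lemma div_mean_pow_three_le {a x y z w : ℝ} (ha : 0 ≤ a) (hx : 0 < x) (hy : 0 < y) (hz : 0 < z)
    (hw : w = (x + y + z) / 3) : a / w ^ 3 ≤ a / (x * y * z) := by
  subst hw
  exact div_le_div_of_nonneg_left ha (by positivity) (mul_mul_le_mean_pow_three hx.le hy.le hz.le)

lemma mul_le_mul_mean_pow_three {a x y z w : ℝ} (ha : 0 ≤ a) (hx : 0 ≤ x) (hy : 0 ≤ y)
    (hz : 0 ≤ z) (hw : w = (x + y + z) / 3) : a * (x * y * z) ≤ a * w ^ 3 := by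
  subst hw
  exact mul_le_mul_of_nonneg_left (mul_mul_le_mean_pow_three hx hy hz) ha

/-- The weighted harmonic mean of `1` and `1 / t` is at most their weighted arithmetic mean. -/
lemma one_div_one_sub_add_mul_le {s t : ℝ} (hs₀ : 0 ≤ s) (hs₁ : s ≤ 1) (ht : 0 < t) :
    1 / (1 - s + s * t) ≤ 1 - s + s / t := by
  have hq := one_sub_add_mul_pos hs₀ hs₁ ht
  have : 1 - s + s / t - 1 / (1 - s + s * t)
      = s * (1 - s) * (t - 1) ^ 2 / (t * (1 - s + s * t)) := by
    field_simp; ring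
  have h2 : 0 ≤ s * (1 - s) * (t - 1) ^ 2 / (t * (1 - s + s * t)) := by
    have : 0 ≤ 1 - s := by linarith
    positivity
  linarith

section PowerBounds

variable {μ t : ℝ}

lemma hasDerivAt_affine (a b x : ℝ) : HasDerivAt (fun x => a + b * x) b x := by
  simpa using ((hasDerivAt_id x).const_mul b).const_add a

lemma hasDerivAt_sub_one_sq (x : ℝ) : HasDerivAt (fun x : ℝ => (x - 1) ^ 2) (2 * (x - 1)) x := by
  simpa using ((hasDerivAt_id' x).sub_const 1).fun_pow 2

/-- The left-hand quotient agrees with `t ^ (-μ)` to third order at `1`, which is what determines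
the weight `(2 - μ) / 3`; so the sign condition is a multiple of `(t - 1)⁴`. The same holds for the
weights in the three bounds after this one. -/
lemma rpow_neg_ge_arith (hμ₀ : 0 ≤ μ) (hμ₁ : μ ≤ 1) (ht : 0 < t) :
    ((1 - μ + μ * t) * (1 - (2 - μ) / 3 + (2 - μ) / 3 * t) + μ * (1 - μ) / 2 * (t - 1) ^ 2) /
      ((1 - μ + μ * t) * (1 - μ + μ * t) * (1 - (2 - μ) / 3 + (2 - μ) / 3 * t)) ≤ t ^ (-μ) := by
  have hν : 0 ≤ 1 - μ := by linarith
  have hν2 : 0 ≤ 2 - μ := by linarith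
  have dm := hasDerivAt_affine (1 - μ) μ
  have dq := hasDerivAt_affine (1 - (2 - μ) / 3) ((2 - μ) / 3)
  refine div_le_rpow_neg_of_sign
    (fun x => ((dm x).mul (dq x)).add ((hasDerivAt_sub_one_sq x).const_mul (μ * (1 - μ) / 2)))
    (fun x => ((dm x).mul (dm x)).mul (dq x)) (fun x hx => ?_) ?_ (fun x hx => ?_) ht
  · have hm := one_sub_add_mul_pos hμ₀ hμ₁ hx
    have hq := one_sub_add_mul_pos (s := (2 - μ) / 3) (by linarith) (by linarith) hx
    exact mul_pos (mul_pos hm hm) hq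
  · simp
  · have hm := one_sub_add_mul_pos hμ₀ hμ₁ hx
    have key : 0 ≤ (x - 1) ^ 4 * (1 - μ + μ * x) *
        ((μ * ((2 - μ) / 3) + μ * (1 - μ) / 2) * (μ * ((2 - μ) / 3) * (1 - μ)) * x +
          μ * (1 - μ) * ((1 + μ) / 3) * ((1 - μ) * ((1 + μ) / 3) + μ * (1 - μ) / 2)) := by
      positivity
    simp only [Pi.mul_apply, Pi.add_apply]
    rw [← neg_nonneg]
    convert key using 1
    ring

lemma rpow_neg_le_arith (hμ₀ : 0 ≤ μ) (hμ₁ : μ ≤ 1) (ht : 0 < t) :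
    t ^ (-μ) ≤ ((1 - μ + μ * t) * t +
        μ * (1 - μ) / 2 * (t - 1) ^ 2 * ((2 - μ) / 3 + (1 - (2 - μ) / 3) * t)) /
      (t * ((1 - μ + μ * t) * (1 - μ + μ * t))) := by
  have hν : 0 ≤ 1 - μ := by linarith
  have hν2 : 0 ≤ 2 - μ := by linarith
  have dm := hasDerivAt_affine (1 - μ) μ
  have dq := hasDerivAt_affine ((2 - μ) / 3) (1 - (2 - μ) / 3)
  refine rpow_neg_le_div_of_sign
    (fun x => ((dm x).mul (hasDerivAt_id' x)).add
      (((hasDerivAt_sub_one_sq x).const_mul (μ * (1 - μ) / 2)).mul (dq x)))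
    (fun x => (hasDerivAt_id' x).mul ((dm x).mul (dm x))) (fun x hx => ?_) ?_ (fun x hx => ?_) ht
  · have hm := one_sub_add_mul_pos hμ₀ hμ₁ hx
    exact mul_pos hx (mul_pos hm hm)
  · simp
  · have hm := one_sub_add_mul_pos hμ₀ hμ₁ hx
    have key : 0 ≤ (x - 1) ^ 4 * (x * (1 - μ + μ * x)) *
        (μ ^ 2 * (μ * (1 - μ) / 2 * ((1 + μ) / 3)) * x +
          (1 - μ) ^ 2 * (μ * (1 - μ) / 2) * ((2 - μ) / 3)) := by
      positivity
    simp only [Pi.mul_apply, Pi.add_apply]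
    convert key using 1
    ring

lemma rpow_neg_le_harm (hμ₀ : 0 ≤ μ) (hμ₁ : μ ≤ 1) (ht : 0 < t) :
    t ^ (-μ) ≤ ((μ + (1 - μ) * t) * (1 - (μ + 1) / 3 + (μ + 1) / 3 * t) -
        μ * (1 - μ) / 2 * (t - 1) ^ 2) /
      (t * (1 - (μ + 1) / 3 + (μ + 1) / 3 * t)) := by
  have hν : 0 ≤ 1 - μ := by linarith
  have hν2 : 0 ≤ 2 - μ := by linarith
  have dm := hasDerivAt_affine μ (1 - μ)
  have dq := hasDerivAt_affine (1 - (μ + 1) / 3) ((μ + 1) / 3)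
  refine rpow_neg_le_div_of_sign
    (fun x => ((dm x).mul (dq x)).sub ((hasDerivAt_sub_one_sq x).const_mul (μ * (1 - μ) / 2)))
    (fun x => (hasDerivAt_id' x).mul (dq x)) (fun x hx => ?_) ?_ (fun x hx => ?_) ht
  · exact mul_pos hx (one_sub_add_mul_pos (by linarith) (by linarith) hx)
  · simp
  · have key : 0 ≤ (x - 1) ^ 4 * x * (μ * ((μ + 1) / 3) * ((1 - μ) * (2 - μ) / 6)) := by
      positivity
    simp only [Pi.mul_apply, Pi.sub_apply]
    convert key using 1
    ring

lemma rpow_neg_ge_harm (hμ₀ : 0 ≤ μ) (hμ₁ : μ ≤ 1) (ht : 0 < t) :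
    ((μ + (1 - μ) * t) * t -
        μ * (1 - μ) / 2 * (t - 1) ^ 2 * ((μ + 1) / 3 + (1 - (μ + 1) / 3) * t)) / (t * t)
      ≤ t ^ (-μ) := by
  have hν : 0 ≤ 1 - μ := by linarith
  have hν2 : 0 ≤ 2 - μ := by linarith
  have dm := hasDerivAt_affine μ (1 - μ)
  have dq := hasDerivAt_affine ((μ + 1) / 3) (1 - (μ + 1) / 3)
  refine div_le_rpow_neg_of_sign
    (fun x => ((dm x).mul (hasDerivAt_id' x)).sub
      (((hasDerivAt_sub_one_sq x).const_mul (μ * (1 - μ) / 2)).mul (dq x)))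
    (fun x => (hasDerivAt_id' x).mul (hasDerivAt_id' x)) (fun x hx => mul_pos hx hx) ?_
    (fun x hx => ?_) ht
  · simp
  · have key : 0 ≤ (x - 1) ^ 4 * x ^ 2 * ((μ + 1) * (μ * (1 - μ) / 2) * ((2 - μ) / 3)) := by
      positivity
    simp only [Pi.mul_apply, Pi.sub_apply]
    rw [← neg_nonneg]
    convert key using 1
    ring

/-- `f` lies between `c (t - 1)² / (1 - s + s t)³` and `c (t - 1)² (1 - s + s / t)³` on `(0, ∞)`.
Both bounds are the cube of an inverse weighted mean of `1` and `t`, with the same weight. -/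
def CubicallySandwiched (c s : ℝ) (f : ℝ → ℝ) : Prop :=
  ∀ t, 0 < t → c * (t - 1) ^ 2 / (1 - s + s * t) ^ 3 ≤ f t ∧
    f t ≤ c * (t - 1) ^ 2 * (1 - s + s / t) ^ 3

/-- The weight `(5 μ + 2) / 9` is the mean of the weights `μ`, `μ` and `(2 - μ) / 3` in the three
factors of `rpow_neg_ge_arith`. -/
lemma cubicallySandwiched_geom_sub_arith (hμ₀ : 0 ≤ μ) (hμ₁ : μ ≤ 1) :
    CubicallySandwiched (μ * (1 - μ) / 2) ((5 * μ + 2) / 9)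
      (fun t => t ^ (-μ) - (1 - μ + μ * t)⁻¹) := by
  intro t ht
  have hν : 0 ≤ 1 - μ := by linarith
  have hm := one_sub_add_mul_pos hμ₀ hμ₁ ht
  have hq := one_sub_add_mul_pos (s := (2 - μ) / 3) (by linarith) (by linarith) ht
  have hc : 0 ≤ μ * (1 - μ) / 2 * (t - 1) ^ 2 := by positivity
  constructor
  · refine (div_mean_pow_three_le hc hm hm hq (by ring)).trans ?_
    refine le_trans (le_of_eq ?_) (sub_le_sub_right (rpow_neg_ge_arith hμ₀ hμ₁ ht) _)
    generalize 1 - (2 - μ) / 3 + (2 - μ) / 3 * t = q at hq ⊢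
    field_simp
    ring
  · have hmi : 0 ≤ 1 - μ + μ / t := by positivity
    have hqi : 0 ≤ 1 - (2 - μ) / 3 + (2 - μ) / 3 / t := by
      have : 0 ≤ (2 - μ) / 3 / t := div_nonneg (by linarith) ht.le
      linarith
    refine le_trans ?_ (mul_le_mul_mean_pow_three hc hmi hmi hqi (by ring))
    have hle : 1 / (1 - μ + μ * t) * (1 / (1 - μ + μ * t)) ≤
        (1 - μ + μ / t) * (1 - μ + μ / t) :=
      mul_self_le_mul_self (by positivity) (one_div_one_sub_add_mul_le hμ₀ hμ₁ ht)
    refine le_trans ?_ (mul_le_mul_of_nonneg_left (mul_le_mul_of_nonneg_right hle hqi) hc)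
    refine (sub_le_sub_right (rpow_neg_le_arith hμ₀ hμ₁ ht) _).trans (le_of_eq ?_)
    field_simp
    ring

/-- The weight `(μ + 4) / 9` is the mean of `0`, `1` and `(μ + 1) / 3`, the weights of the factors
`1`, `t` and `1 - (μ + 1) / 3 + (μ + 1) / 3 * t` in `rpow_neg_le_harm`. -/
lemma cubicallySandwiched_harm_sub_geom (hμ₀ : 0 ≤ μ) (hμ₁ : μ ≤ 1) :
    CubicallySandwiched (μ * (1 - μ) / 2) ((μ + 4) / 9)
      (fun t => 1 - μ + μ * t⁻¹ - t ^ (-μ)) := by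
  intro t ht
  have hν : 0 ≤ 1 - μ := by linarith
  have hq := one_sub_add_mul_pos (s := (μ + 1) / 3) (by linarith) (by linarith) ht
  have hc : 0 ≤ μ * (1 - μ) / 2 * (t - 1) ^ 2 := by positivity
  constructor
  · refine (div_mean_pow_three_le hc one_pos ht hq (by ring)).trans ?_
    refine le_trans (le_of_eq ?_) (sub_le_sub_left (rpow_neg_le_harm hμ₀ hμ₁ ht) _)
    generalize 1 - (μ + 1) / 3 + (μ + 1) / 3 * t = q at hq ⊢
    field_simp
    ring
  · have hqi : 0 ≤ 1 - (μ + 1) / 3 + (μ + 1) / 3 / t := by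
      have : 0 ≤ (μ + 1) / 3 / t := by positivity
      linarith
    refine le_trans ?_ (mul_le_mul_mean_pow_three hc zero_le_one (one_div_pos.2 ht).le hqi
      (by ring))
    refine (sub_le_sub_left (rpow_neg_ge_harm hμ₀ hμ₁ ht) _).trans (le_of_eq ?_)
    field_simp
    ring

/-- Here `f(t) = μ (1 - μ) (t - 1)² / (t (1 - μ + μ t))`, and the weight `(μ + 1) / 3` is the mean
of the weights `0`, `1` and `μ` of the factors `1`, `t` and `1 - μ + μ t`. -/
lemma cubicallySandwiched_harm_sub_arith (hμ₀ : 0 ≤ μ) (hμ₁ : μ ≤ 1) :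
    CubicallySandwiched (μ * (1 - μ)) ((μ + 1) / 3)
      (fun t => 1 - μ + μ * t⁻¹ - (1 - μ + μ * t)⁻¹) := by
  intro t ht
  have hν : 0 ≤ 1 - μ := by linarith
  have hm := one_sub_add_mul_pos hμ₀ hμ₁ ht
  have hc : 0 ≤ μ * (1 - μ) * (t - 1) ^ 2 := by positivity
  have heq : 1 - μ + μ * t⁻¹ - (1 - μ + μ * t)⁻¹ =
      μ * (1 - μ) * (t - 1) ^ 2 / (1 * t * (1 - μ + μ * t)) := by
    field_simp
    ring
  simp only [heq]
  constructor
  · exact div_mean_pow_three_le hc one_pos ht hm (by ring)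
  · have hmi : 0 ≤ 1 - μ + μ / t := by positivity
    refine le_trans ?_ (mul_le_mul_mean_pow_three hc zero_le_one (one_div_pos.2 ht).le hmi
      (by ring))
    refine le_trans (le_of_eq ?_) (mul_le_mul_of_nonneg_left (mul_le_mul_of_nonneg_left
      (one_div_one_sub_add_mul_le hμ₀ hμ₁ ht) (by positivity : 0 ≤ 1 * (1 / t))) hc)
    field_simp

end PowerBounds

/-! ### Eigenvalues of compact positive operators -/

section MinMax

open Module End ContinuousLinearMap
open scoped InnerProductSpace

variable {H : Type*} [NormedAddCommGroup H] [InnerProductSpace ℂ H]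

/-- The quadratic form of a positive operator is at least `t` on the sum of the eigenspaces of the
eigenvalues `s ≥ t`. -/
lemma mul_norm_sq_le_of_mem_iSup_eigenspace {T : H →L[ℂ] H} (hT : T.IsPositive) {t : ℝ} {x : H}
    (hx : x ∈ (⨆ s ∈ Set.Ici t, eigenspace (T : H →ₗ[ℂ] H) (s : ℂ) : Submodule ℂ H)) :
    t * ‖x‖ ^ 2 ≤ T.reApplyInnerSelf x := by
  rw [iSup_subtype', Submodule.mem_iSup_iff_exists_finsupp] at hx
  obtain ⟨f, hf, rfl⟩ := hx
  have hV := hT.isSymmetric.orthogonalFamily_eigenspaces.comp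
    (f := fun s : Set.Ici t => ((s : ℝ) : ℂ))
    (Complex.ofReal_injective.comp Subtype.val_injective)
  let l (s : Set.Ici t) : eigenspace (T : H →ₗ[ℂ] H) ((s : ℝ) : ℂ) := ⟨f s, hf s⟩
  have hTf : T (∑ s ∈ f.support, f s) = ∑ s ∈ f.support, ((((s : ℝ) : ℂ) • l s :) : H) := by
    rw [map_sum]
    exact Finset.sum_congr rfl fun s _ => mem_eigenspace_iff.1 (hf s)
  have h1 := hV.inner_sum (fun s => ((s : ℝ) : ℂ) • l s) l f.support
  have h2 := hV.norm_sum l f.support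
  rw [reApplyInnerSelf_apply, Finsupp.sum, hTf]
  change t * ‖∑ s ∈ f.support, (l s : H)‖ ^ 2 ≤
    RCLike.re ⟪∑ s ∈ f.support, ((((s : ℝ) : ℂ) • l s :) : H), ∑ s ∈ f.support, (l s : H)⟫_ℂ
  erw [h1, h2]
  rw [Finset.mul_sum, map_sum]
  refine Finset.sum_le_sum fun s _ => ?_
  rw [inner_smul_left, inner_self_eq_norm_sq_to_K]
  have : RCLike.re ((starRingEnd ℂ) ((s : ℝ) : ℂ) * ((‖l s‖ : ℝ) : ℂ) ^ 2) = s * ‖l s‖ ^ 2 := by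
    rw [Complex.conj_ofReal, ← Complex.ofReal_pow, ← Complex.ofReal_mul]
    exact Complex.ofReal_re _
  exact (mul_le_mul_of_nonneg_right s.2 (sq_nonneg _)).trans_eq this.symm

lemma reApplyInnerSelf_le_norm_mul_sq (T : H →L[ℂ] H) (x : H) :
    T.reApplyInnerSelf x ≤ ‖T‖ * ‖x‖ ^ 2 := by
  rw [reApplyInnerSelf_apply]
  calc RCLike.re ⟪T x, x⟫_ℂ ≤ ‖T x‖ * ‖x‖ := re_inner_le_norm _ _
    _ ≤ ‖T‖ * ‖x‖ * ‖x‖ := by gcongr; exact T.le_opNorm x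
    _ = ‖T‖ * ‖x‖ ^ 2 := by ring

lemma orderedEigenvalue_nonneg (T : H →L[ℂ] H) (j : ℕ) : 0 ≤ orderedEigenvalue T j :=
  Real.sSup_nonneg fun _ ht => ht.1.le

variable [CompleteSpace H]

/-- The norm of a compact positive operator is an eigenvalue. -/
lemma exists_eigenvector_norm {T : H →L[ℂ] H} (hT : T.IsPositive) (hc : IsCompactOperator T)
    (h0 : T ≠ 0) : ∃ v : H, v ≠ 0 ∧ T v = (‖T‖ : ℂ) • v := by
  have : Nontrivial H := by
    by_contra h
    rw [not_nontrivial_iff_subsingleton] at h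
    exact h0 (Subsingleton.elim _ _)
  have hs : (‖T‖ : ℂ) ∈ spectrum ℂ T := by
    have := CStarAlgebra.norm_mem_spectrum_of_nonneg (a := T) ((nonneg_iff_isPositive T).2 hT)
    simpa using spectrum.algebraMap_mem ℂ this
  have hev := (hc.hasEigenvalue_iff_mem_spectrum (by simpa using h0)).2 hs
  obtain ⟨v, hv⟩ := hev.exists_hasEigenvector
  exact ⟨v, hv.2, hv.apply_eq_smul⟩

/-- The quadratic form of a compact positive operator is less than `t` on the orthogonal
complement of the eigenspaces of the eigenvalues `s ≥ t`. -/
lemma reApplyInnerSelf_lt_of_mem_orthogonal {T : H →L[ℂ] H} (hT : T.IsPositive)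
    (hc : IsCompactOperator T) {t : ℝ} (ht : 0 < t) {x : H} (hx0 : x ≠ 0)
    (hx : x ∈ (⨆ s ∈ Set.Ici t, eigenspace (T : H →ₗ[ℂ] H) (s : ℂ) : Submodule ℂ H)ᗮ) :
    T.reApplyInnerSelf x < t * ‖x‖ ^ 2 := by
  set E : Submodule ℂ H := ⨆ s ∈ Set.Ici t, eigenspace (T : H →ₗ[ℂ] H) (s : ℂ) with hE
  -- `T` restricts to the orthogonal complement, where its norm is an eigenvalue unless it is `0`.
  have hinv : ∀ v ∈ E, T v ∈ E := by
    intro v hv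
    have hle : E ≤ E.comap (T : H →ₗ[ℂ] H) := by
      conv_lhs => rw [hE]
      refine iSup₂_le fun s hs v hv => ?_
      have h1 := mem_eigenspace_iff.1 hv
      rw [Submodule.mem_comap, h1]
      exact E.smul_mem _ (Submodule.mem_iSup_of_mem s (Submodule.mem_iSup_of_mem hs hv))
    exact hle hv
  have hinv' : ∀ v ∈ Eᗮ, T v ∈ Eᗮ := by
    intro v hv u hu
    have h1 : ⟪T u, v⟫_ℂ = ⟪u, T v⟫_ℂ := hT.isSymmetric u v
    rw [← h1]
    exact hv _ (hinv u hu)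
  let S : Eᗮ →L[ℂ] Eᗮ := T.restrict hinv'
  have hSc : IsCompactOperator S := hc.restrict' hinv'
  have hSp : S.IsPositive := by
    refine ⟨fun u v => ?_, fun v => ?_⟩
    · exact hT.isSymmetric (u : H) (v : H)
    · exact hT.re_inner_nonneg_left (v : H)
  have hlt : ‖S‖ < t := by
    by_contra! hcon
    obtain ⟨v, hv0, hv⟩ := exists_eigenvector_norm hSp hSc (by
      rintro h
      have h0 : ‖S‖ = 0 := by rw [h]; exact ContinuousLinearMap.opNorm_zero
      linarith)
    have hvE : (v : H) ∈ E := by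
      refine Submodule.mem_iSup_of_mem ‖S‖ (Submodule.mem_iSup_of_mem hcon ?_)
      exact mem_eigenspace_iff.2 (congrArg Subtype.val hv)
    exact hv0 (Subtype.ext (inner_self_eq_zero.1 (v.2 _ hvE)))
  have h1 := reApplyInnerSelf_le_norm_mul_sq S ⟨x, hx⟩
  have h2 : 0 < ‖x‖ ^ 2 := by positivity
  exact lt_of_le_of_lt h1 (mul_lt_mul_of_pos_right hlt h2)

/-- The min-max principle: at least `j` eigenvalues are `≥ t` if and only if the quadratic form is
at least `t` on a subspace of dimension `j`, given here as an injective image of `ℂ^j`. -/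
lemma natCast_le_eigenvalueCount_iff {T : H →L[ℂ] H} (hT : T.IsPositive)
    (hc : IsCompactOperator T) {t : ℝ} (ht : 0 < t) (j : ℕ) :
    (j : Cardinal) ≤ eigenvalueCount T t ↔ ∃ φ : (Fin j → ℂ) →ₗ[ℂ] H, Function.Injective φ ∧
      ∀ x, t * ‖φ x‖ ^ 2 ≤ T.reApplyInnerSelf (φ x) := by
  set E : Submodule ℂ H := ⨆ s ∈ Set.Ici t, eigenspace (T : H →ₗ[ℂ] H) (s : ℂ) with hE
  constructor
  · intro h
    obtain ⟨φ, hφ⟩ := Module.le_rank_iff_exists_linearMap.1 h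
    exact ⟨E.subtype.comp φ, Subtype.val_injective.comp hφ,
      fun x => mul_norm_sq_le_of_mem_iSup_eigenspace hT (φ x).2⟩
  · rintro ⟨φ, hφ, h⟩
    by_contra! hlt
    change Module.rank ℂ E < j at hlt
    have hfin : FiniteDimensional ℂ E :=
      Module.rank_lt_aleph0_iff.1 (hlt.trans (Cardinal.natCast_lt_aleph0 (n := j)))
    rw [← Module.finrank_eq_rank, Nat.cast_lt] at hlt
    -- By dimension, the given subspace meets the orthogonal complement of `E`.
    have hker : LinearMap.ker ((E.orthogonalProjectionOnto : H →ₗ[ℂ] E).comp φ) ≠ ⊥ :=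
      LinearMap.ker_ne_bot_of_finrank_lt (by simpa using hlt)
    obtain ⟨x, hx, hx0⟩ := Submodule.exists_mem_ne_zero_of_ne_bot hker
    have hmem : φ x ∈ Eᗮ := by
      simpa using hx
    have hφ0 : φ x ≠ 0 := by
      rwa [Ne, map_eq_zero_iff φ hφ]
    exact (h x).not_gt (reApplyInnerSelf_lt_of_mem_orthogonal hT hc ht hφ0 hmem)

lemma bddAbove_eigenvalueCount_levels {T : H →L[ℂ] H} (hT : T.IsPositive)
    (hc : IsCompactOperator T) {j : ℕ} (hj : 1 ≤ j) :
    ‖T‖ ∈ upperBounds {t : ℝ | 0 < t ∧ (j : Cardinal) ≤ eigenvalueCount T t} := by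
  rintro t ⟨ht, h⟩
  obtain ⟨φ, hφ, h⟩ := (natCast_le_eigenvalueCount_iff hT hc ht j).1 h
  have : Nonempty (Fin j) := ⟨⟨0, hj⟩⟩
  have h1 : φ 1 ≠ 0 := by
    rw [Ne, map_eq_zero_iff φ hφ]; exact one_ne_zero
  exact le_of_mul_le_mul_right ((h 1).trans (reApplyInnerSelf_le_norm_mul_sq T _))
    (by positivity)

/-- An injective linear map that carries the lower bounds for the quadratic form of `S` to those
for the quadratic form of `T` carries subspaces to subspaces of the same dimension, and so compares
the eigenvalues. -/
lemma orderedEigenvalue_le_of_transport {S T : H →L[ℂ] H} (hS : S.IsPositive)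
    (hSc : IsCompactOperator S) (hT : T.IsPositive) (hTc : IsCompactOperator T)
    (L : H →ₗ[ℂ] H) (hL : Function.Injective L)
    (h : ∀ t, 0 < t → ∀ x, t * ‖x‖ ^ 2 ≤ S.reApplyInnerSelf x →
      t * ‖L x‖ ^ 2 ≤ T.reApplyInnerSelf (L x)) {j : ℕ} (hj : 1 ≤ j) :
    orderedEigenvalue S j ≤ orderedEigenvalue T j := by
  refine Real.sSup_le (fun t ht => ?_) (orderedEigenvalue_nonneg T j)
  refine le_csSup ⟨_, bddAbove_eigenvalueCount_levels hT hTc hj⟩ ⟨ht.1, ?_⟩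
  obtain ⟨φ, hφ, hb⟩ := (natCast_le_eigenvalueCount_iff hS hSc ht.1 j).1 ht.2
  exact (natCast_le_eigenvalueCount_iff hT hTc ht.1 j).2
    ⟨L.comp φ, hL.comp hφ, fun x => h t ht.1 _ (hb x)⟩

lemma orderedEigenvalue_one {T : H →L[ℂ] H} (hT : T.IsPositive) (hc : IsCompactOperator T) :
    orderedEigenvalue T 1 = ‖T‖ := by
  refine le_antisymm (Real.sSup_le (bddAbove_eigenvalueCount_levels hT hc le_rfl) (norm_nonneg _))
    ?_
  rcases eq_or_ne T 0 with h0 | h0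
  · rw [h0, norm_zero]; exact orderedEigenvalue_nonneg _ _
  obtain ⟨v, hv0, hv⟩ := exists_eigenvector_norm hT hc h0
  refine le_csSup ⟨_, bddAbove_eigenvalueCount_levels hT hc le_rfl⟩ ⟨norm_pos_iff.2 h0, ?_⟩
  rw [Nat.cast_one, Cardinal.one_le_iff_ne_zero, eigenvalueCount, Ne, rank_zero_iff,
    not_subsingleton_iff_nontrivial, Submodule.nontrivial_iff_ne_bot]
  refine Submodule.ne_bot_iff _ |>.2 ⟨v, ?_, hv0⟩
  exact Submodule.mem_iSup_of_mem ‖T‖ (Submodule.mem_iSup_of_mem (Set.mem_Ici.2 le_rfl)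
    (mem_eigenspace_iff.2 hv))

end MinMax

/-! ### Perspectives of positive operators -/

section Perspective

open ContinuousLinearMap
open scoped InnerProductSpace

variable {H : Type*} [NormedAddCommGroup H] [InnerProductSpace ℂ H] [CompleteSpace H]
  {A B : H →L[ℂ] H}

/-- The operator `A^{-1/2} B A^{-1/2}`, which is the quotient of `B` by `A` if they commute. -/
noncomputable def relQuotient (A B : H →L[ℂ] H) : H →L[ℂ] H :=
  A ^ (-(1 / 2) : ℝ) * B * A ^ (-(1 / 2) : ℝ)

/-- The operator `A^{-1/2} f(A^{-1/2} B A^{-1/2}) A^{-1/2}`; it is the perspective of `f`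
of degree `-1`, equal to `A⁻¹ f(B / A)` if `A` and `B` commute. -/
noncomputable def invPerspective (f : ℝ → ℝ) (A B : H →L[ℂ] H) : H →L[ℂ] H :=
  A ^ (-(1 / 2) : ℝ) * cfc f (relQuotient A B) * A ^ (-(1 / 2) : ℝ)

/-- The operator `A^{1/2} f(A^{-1/2} B A^{-1/2}) A^{1/2}`; it is the perspective of `f`
of degree `1`, equal to `A f(B / A)` if `A` and `B` commute. -/
noncomputable def perspective (f : ℝ → ℝ) (A B : H →L[ℂ] H) : H →L[ℂ] H :=
  A ^ (1 / 2 : ℝ) * cfc f (relQuotient A B) * A ^ (1 / 2 : ℝ)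

lemma rpow_half_mul_rpow_neg_half (hA : IsStrictlyPositive A) :
    A ^ (1 / 2 : ℝ) * A ^ (-(1 / 2) : ℝ) = 1 :=
  CFC.rpow_mul_rpow_neg _ hA

lemma rpow_neg_half_mul_rpow_half (hA : IsStrictlyPositive A) :
    A ^ (-(1 / 2) : ℝ) * A ^ (1 / 2 : ℝ) = 1 :=
  CFC.rpow_neg_mul_rpow _ hA

lemma rpow_half_mul_rpow_half (hA : IsStrictlyPositive A) :
    A ^ (1 / 2 : ℝ) * A ^ (1 / 2 : ℝ) = A := by
  rw [← CFC.rpow_add hA.isUnit, add_halves, CFC.rpow_one A hA.nonneg]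

lemma star_rpow (A : H →L[ℂ] H) (y : ℝ) : star (A ^ y) = A ^ y :=
  (IsSelfAdjoint.of_nonneg CFC.rpow_nonneg).star_eq

lemma isStrictlyPositive_relQuotient (hA : IsStrictlyPositive A) (hB : IsStrictlyPositive B) :
    IsStrictlyPositive (relQuotient A B) := by
  refine ⟨?_, ?_⟩
  · have := star_left_conjugate_nonneg hB.nonneg (A ^ (-(1 / 2) : ℝ))
    rwa [star_rpow] at this
  · have hu : IsUnit (A ^ (-(1 / 2) : ℝ)) := (hA.rpow A _).isUnit
    exact (hu.mul hB.isUnit).mul hu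

lemma spectrum_relQuotient_subset (hA : IsStrictlyPositive A) (hB : IsStrictlyPositive B) :
    spectrum ℝ (relQuotient A B) ⊆ Set.Ioi 0 := fun _ hx =>
  (isStrictlyPositive_relQuotient hA hB).spectrum_pos hx

lemma isSelfAdjoint_relQuotient (hA : IsStrictlyPositive A) (hB : IsStrictlyPositive B) :
    IsSelfAdjoint (relQuotient A B) :=
  .of_nonneg (isStrictlyPositive_relQuotient hA hB).nonneg

lemma invPerspective_mul_perspective (hA : IsStrictlyPositive A) (hB : IsStrictlyPositive B)
    {f g : ℝ → ℝ} (hf : ContinuousOn f (Set.Ioi 0)) (hg : ContinuousOn g (Set.Ioi 0)) :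
    invPerspective f A B * perspective g A B =
      A ^ (-(1 / 2) : ℝ) * cfc (fun t => f t * g t) (relQuotient A B) * A ^ (1 / 2 : ℝ) := by
  have hs := spectrum_relQuotient_subset hA hB
  rw [cfc_mul f g _ (hf.mono hs) (hg.mono hs), invPerspective, perspective]
  simp only [mul_assoc]
  rw [← mul_assoc (A ^ (-(1 / 2) : ℝ)) (A ^ (1 / 2 : ℝ)), rpow_neg_half_mul_rpow_half hA, one_mul]

lemma perspective_mul_invPerspective (hA : IsStrictlyPositive A) (hB : IsStrictlyPositive B)
    {f g : ℝ → ℝ} (hf : ContinuousOn f (Set.Ioi 0)) (hg : ContinuousOn g (Set.Ioi 0)) :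
    perspective g A B * invPerspective f A B =
      A ^ (1 / 2 : ℝ) * cfc (fun t => g t * f t) (relQuotient A B) * A ^ (-(1 / 2) : ℝ) := by
  have hs := spectrum_relQuotient_subset hA hB
  rw [cfc_mul g f _ (hg.mono hs) (hf.mono hs), invPerspective, perspective]
  simp only [mul_assoc]
  rw [← mul_assoc (A ^ (1 / 2 : ℝ)) (A ^ (-(1 / 2) : ℝ)), rpow_half_mul_rpow_neg_half hA, one_mul]

lemma invPerspective_mul_perspective_mul_invPerspective (hA : IsStrictlyPositive A)
    (hB : IsStrictlyPositive B) {f g h : ℝ → ℝ} (hf : ContinuousOn f (Set.Ioi 0))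
    (hg : ContinuousOn g (Set.Ioi 0)) (hh : ContinuousOn h (Set.Ioi 0)) :
    invPerspective f A B * perspective g A B * invPerspective h A B =
      invPerspective (fun t => f t * g t * h t) A B := by
  have hs := spectrum_relQuotient_subset hA hB
  rw [invPerspective_mul_perspective hA hB hf hg, invPerspective, invPerspective,
    cfc_mul (fun t => f t * g t) h _ ((hf.mul hg).mono hs) (hh.mono hs)]
  simp only [mul_assoc]
  rw [← mul_assoc (A ^ (1 / 2 : ℝ)) (A ^ (-(1 / 2) : ℝ)), rpow_half_mul_rpow_neg_half hA, one_mul]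

lemma cfc_congr_Ioi (hA : IsStrictlyPositive A) (hB : IsStrictlyPositive B) {f g : ℝ → ℝ}
    (h : ∀ t, 0 < t → f t = g t) : cfc f (relQuotient A B) = cfc g (relQuotient A B) :=
  cfc_congr fun t ht => h t (spectrum_relQuotient_subset hA hB ht)

lemma invPerspective_mul_perspective_eq_one (hA : IsStrictlyPositive A)
    (hB : IsStrictlyPositive B) {f g : ℝ → ℝ} (hf : ContinuousOn f (Set.Ioi 0))
    (hg : ContinuousOn g (Set.Ioi 0)) (h : ∀ t, 0 < t → f t * g t = 1) :
    invPerspective f A B * perspective g A B = 1 := by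
  rw [invPerspective_mul_perspective hA hB hf hg, cfc_congr_Ioi hA hB h,
    cfc_const_one ℝ _ (isSelfAdjoint_relQuotient hA hB), mul_one,
    rpow_neg_half_mul_rpow_half hA]

lemma perspective_mul_invPerspective_eq_one (hA : IsStrictlyPositive A)
    (hB : IsStrictlyPositive B) {f g : ℝ → ℝ} (hf : ContinuousOn f (Set.Ioi 0))
    (hg : ContinuousOn g (Set.Ioi 0)) (h : ∀ t, 0 < t → f t * g t = 1) :
    perspective g A B * invPerspective f A B = 1 := by
  rw [perspective_mul_invPerspective hA hB hf hg,
    cfc_congr_Ioi hA hB fun t ht => (mul_comm _ _).trans (h t ht),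
    cfc_const_one ℝ _ (isSelfAdjoint_relQuotient hA hB), mul_one,
    rpow_half_mul_rpow_neg_half hA]

lemma inverse_perspective (hA : IsStrictlyPositive A)
    (hB : IsStrictlyPositive B) {f g : ℝ → ℝ} (hf : ContinuousOn f (Set.Ioi 0))
    (hg : ContinuousOn g (Set.Ioi 0)) (h : ∀ t, 0 < t → f t * g t = 1) :
    Ring.inverse (perspective g A B) = invPerspective f A B :=
  Ring.inverse_unit ⟨perspective g A B, invPerspective f A B,
    perspective_mul_invPerspective_eq_one hA hB hf hg h,
    invPerspective_mul_perspective_eq_one hA hB hf hg h⟩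

lemma perspective_const_one (hA : IsStrictlyPositive A) (hB : IsStrictlyPositive B) :
    perspective (fun _ => 1) A B = A := by
  rw [perspective, cfc_const_one ℝ _ (isSelfAdjoint_relQuotient hA hB), mul_one,
    rpow_half_mul_rpow_half hA]

lemma perspective_id (hA : IsStrictlyPositive A) (hB : IsStrictlyPositive B) :
    perspective (fun t => t) A B = B := by
  rw [perspective, cfc_id' ℝ _ (isSelfAdjoint_relQuotient hA hB), relQuotient]
  calc A ^ (1 / 2 : ℝ) * (A ^ (-(1 / 2) : ℝ) * B * A ^ (-(1 / 2) : ℝ)) * A ^ (1 / 2 : ℝ)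
      = (A ^ (1 / 2 : ℝ) * A ^ (-(1 / 2) : ℝ)) * B * (A ^ (-(1 / 2) : ℝ) * A ^ (1 / 2 : ℝ)) := by
        noncomm_ring
    _ = B := by
        rw [rpow_half_mul_rpow_neg_half hA, rpow_neg_half_mul_rpow_half hA, one_mul, mul_one]

lemma perspective_affine (hA : IsStrictlyPositive A) (hB : IsStrictlyPositive B) (a b : ℝ) :
    perspective (fun t => a + b * t) A B = a • A + b • B := by
  have hs := isSelfAdjoint_relQuotient hA hB
  have h : perspective (fun t => a + b * t) A B =
      a • perspective (fun _ => 1) A B + b • perspective (fun t => t) A B := by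
    rw [perspective, cfc_add _ (fun _ => a) (fun t => b * t), cfc_const_mul b (fun t => t) _,
      cfc_const a _ hs, perspective, perspective, cfc_const_one ℝ _ hs, mul_add, add_mul,
      Algebra.algebraMap_eq_smul_one]
    simp only [mul_smul_comm, smul_mul_assoc]
  rw [h, perspective_const_one hA hB, perspective_id hA hB]

lemma invPerspective_const_one (hA : IsStrictlyPositive A) (hB : IsStrictlyPositive B) :
    invPerspective (fun _ => 1) A B = Ring.inverse A := by
  conv_rhs => rw [← perspective_const_one hA hB]
  exact (inverse_perspective hA hB continuousOn_const continuousOn_const (by simp)).symm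

lemma continuousOn_inv_Ioi : ContinuousOn (fun t : ℝ => t⁻¹) (Set.Ioi 0) :=
  continuousOn_id.inv₀ fun _ ht => (Set.mem_Ioi.1 ht).ne'

lemma invPerspective_inv (hA : IsStrictlyPositive A) (hB : IsStrictlyPositive B) :
    invPerspective (fun t => t⁻¹) A B = Ring.inverse B := by
  conv_rhs => rw [← perspective_id hA hB]
  exact (inverse_perspective hA hB continuousOn_inv_Ioi continuousOn_id
    (fun t ht => inv_mul_cancel₀ ht.ne')).symm

lemma invPerspective_sub (hA : IsStrictlyPositive A) (hB : IsStrictlyPositive B) {f g : ℝ → ℝ}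
    (hf : ContinuousOn f (Set.Ioi 0)) (hg : ContinuousOn g (Set.Ioi 0)) :
    invPerspective f A B - invPerspective g A B = invPerspective (fun t => f t - g t) A B := by
  have hs := spectrum_relQuotient_subset hA hB
  rw [invPerspective, invPerspective, invPerspective,
    cfc_sub f g _ (hf.mono hs) (hg.mono hs), mul_sub, sub_mul]

lemma invPerspective_add_mul_inv (hA : IsStrictlyPositive A) (hB : IsStrictlyPositive B)
    (a b : ℝ) :
    invPerspective (fun t => a + b * t⁻¹) A B = a • Ring.inverse A + b • Ring.inverse B := by
  have hs := spectrum_relQuotient_subset hA hB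
  have hsa := isSelfAdjoint_relQuotient hA hB
  have hi := continuousOn_inv_Ioi.mono hs
  rw [← invPerspective_const_one hA hB, ← invPerspective_inv hA hB]
  rw [invPerspective, cfc_add _ (fun _ => a) (fun t => b * t⁻¹) continuousOn_const
    (continuousOn_const.mul hi), cfc_const_mul b (fun t => t⁻¹) _ hi,
    cfc_const a _ hsa, invPerspective, invPerspective, cfc_const_one ℝ _ hsa, mul_add, add_mul,
    Algebra.algebraMap_eq_smul_one]
  simp only [mul_smul_comm, smul_mul_assoc]

lemma invPerspective_mono (hA : IsStrictlyPositive A) (hB : IsStrictlyPositive B) {f g : ℝ → ℝ}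
    (hf : ContinuousOn f (Set.Ioi 0)) (hg : ContinuousOn g (Set.Ioi 0))
    (h : ∀ t, 0 < t → f t ≤ g t) : invPerspective f A B ≤ invPerspective g A B := by
  have hs := spectrum_relQuotient_subset hA hB
  have h1 := star_left_conjugate_le_conjugate
    (cfc_mono (fun t ht => h t (hs ht)) (hf.mono hs) (hg.mono hs)) (A ^ (-(1 / 2) : ℝ))
  rwa [star_rpow] at h1

lemma invPerspective_nonneg (hA : IsStrictlyPositive A) (hB : IsStrictlyPositive B) {f : ℝ → ℝ}
    (h : ∀ t, 0 < t → 0 ≤ f t) : 0 ≤ invPerspective f A B := by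
  have hs := spectrum_relQuotient_subset hA hB
  have h1 := star_left_conjugate_nonneg
    (cfc_nonneg (a := relQuotient A B) (fun t ht => h t (hs ht))) (A ^ (-(1 / 2) : ℝ))
  rwa [star_rpow] at h1

/-- If `f 1 = 0`, then `f(C)` is a multiple of `C - 1` for `C = A^{-1/2} B A^{-1/2}`, and `C - 1`
is compact together with `A - B`. -/
lemma isCompactOperator_invPerspective (hA : IsStrictlyPositive A) (hB : IsStrictlyPositive B)
    {f : ℝ → ℝ} (hf : ContinuousOn f (Set.Ioi 0)) (hf1 : f 1 = 0) (hd : DifferentiableAt ℝ f 1)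
    (hc : IsCompactOperator (A - B)) : IsCompactOperator (invPerspective f A B) := by
  have hs := spectrum_relQuotient_subset hA hB
  have hsa := isSelfAdjoint_relQuotient hA hB
  have hds : ContinuousOn (dslope f 1) (Set.Ioi 0) :=
    (continuousOn_dslope (Ioi_mem_nhds one_pos)).2 ⟨hf, hd⟩
  have h1 : cfc f (relQuotient A B) =
      (relQuotient A B - 1) * cfc (dslope f 1) (relQuotient A B) := by
    have h2 : f = fun t => (t - 1) * dslope f 1 t := by
      ext t
      have := sub_smul_dslope f 1 t
      rw [hf1, sub_zero, smul_eq_mul] at this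
      exact this.symm
    conv_lhs => rw [h2]
    rw [cfc_mul (fun t => t - 1) (dslope f 1) _ (by fun_prop) (hds.mono hs),
      cfc_sub (fun t => t) (fun _ => 1) _, cfc_id' ℝ _ hsa, cfc_const_one ℝ _ hsa]
  have h3 : relQuotient A B - 1 = A ^ (-(1 / 2) : ℝ) * (-(A - B)) * A ^ (-(1 / 2) : ℝ) := by
    rw [relQuotient, ← CFC.conjugate_rpow_neg_one_half A hA]
    noncomm_ring
  have h4 : IsCompactOperator (relQuotient A B - 1 : H →L[ℂ] H) := by
    rw [h3]
    exact (hc.neg.clm_comp (A ^ (-(1 / 2) : ℝ))).comp_clm (A ^ (-(1 / 2) : ℝ))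
  rw [invPerspective, h1]
  exact ((h4.comp_clm (cfc (dslope f 1) (relQuotient A B))).clm_comp
    (A ^ (-(1 / 2) : ℝ))).comp_clm (A ^ (-(1 / 2) : ℝ))

lemma invPerspective_self (hA : IsStrictlyPositive A) {f : ℝ → ℝ} (hf1 : f 1 = 0) :
    invPerspective f A A = 0 := by
  rw [invPerspective, relQuotient, CFC.conjugate_rpow_neg_one_half A hA, cfc_apply_one, hf1,
    map_zero, mul_zero, zero_mul]

lemma continuousOn_inv_affine {μ : ℝ} (hμ₀ : 0 ≤ μ) (hμ₁ : μ ≤ 1) :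
    ContinuousOn (fun t : ℝ => (1 - μ + μ * t)⁻¹) (Set.Ioi 0) :=
  ContinuousOn.inv₀ (by fun_prop) fun _ ht => (one_sub_add_mul_pos hμ₀ hμ₁ ht).ne'

lemma continuousOn_rpow_Ioi (p : ℝ) : ContinuousOn (fun t : ℝ => t ^ p) (Set.Ioi 0) :=
  continuousOn_id.rpow_const fun _ ht => Or.inl (Set.mem_Ioi.1 ht).ne'

lemma inverse_arithMean (hA : IsStrictlyPositive A) (hB : IsStrictlyPositive B) {μ : ℝ}
    (hμ₀ : 0 ≤ μ) (hμ₁ : μ ≤ 1) :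
    Ring.inverse (arithMean μ A B) = invPerspective (fun t => (1 - μ + μ * t)⁻¹) A B := by
  rw [arithMean, ← perspective_affine hA hB]
  exact inverse_perspective hA hB (continuousOn_inv_affine hμ₀ hμ₁) (by fun_prop)
    fun t ht => inv_mul_cancel₀ (one_sub_add_mul_pos hμ₀ hμ₁ ht).ne'

lemma inverse_geomMean (hA : IsStrictlyPositive A) (hB : IsStrictlyPositive B) (μ : ℝ) :
    Ring.inverse (geomMean μ A B) = invPerspective (fun t => t ^ (-μ)) A B := by
  have h : geomMean μ A B = perspective (fun t => t ^ μ) A B := by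
    rw [geomMean, perspective, ← CFC.rpow_eq_cfc_real
      (isStrictlyPositive_relQuotient hA hB).nonneg, relQuotient]
  rw [h]
  refine inverse_perspective hA hB (continuousOn_rpow_Ioi _) (continuousOn_rpow_Ioi _)
    fun t ht => ?_
  rw [← Real.rpow_add ht, neg_add_cancel, Real.rpow_zero]

lemma one_sub_add_mul_inv_pos {s t : ℝ} (hs₀ : 0 ≤ s) (hs₁ : s ≤ 1) (ht : 0 < t) :
    0 < 1 - s + s * t⁻¹ :=
  one_sub_add_mul_pos hs₀ hs₁ (inv_pos.2 ht)

lemma continuousOn_add_mul_inv (a b : ℝ) :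
    ContinuousOn (fun t : ℝ => a + b * t⁻¹) (Set.Ioi 0) :=
  continuousOn_const.add (continuousOn_const.mul continuousOn_inv_Ioi)

lemma isUnit_invPerspective_add_mul_inv (hA : IsStrictlyPositive A) (hB : IsStrictlyPositive B)
    {s : ℝ} (hs₀ : 0 ≤ s) (hs₁ : s ≤ 1) :
    IsUnit (invPerspective (fun t => 1 - s + s * t⁻¹) A B) := by
  have hc := continuousOn_add_mul_inv (1 - s) s
  have hp : ∀ t : ℝ, 0 < t → 1 - s + s * t⁻¹ ≠ 0 := fun t ht =>
    (one_sub_add_mul_inv_pos hs₀ hs₁ ht).ne'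
  have hi : ContinuousOn (fun t : ℝ => (1 - s + s * t⁻¹)⁻¹) (Set.Ioi 0) := hc.inv₀ hp
  exact ⟨⟨_, _,
    invPerspective_mul_perspective_eq_one hA hB hc hi fun t ht => mul_inv_cancel₀ (hp t ht),
    perspective_mul_invPerspective_eq_one hA hB hc hi fun t ht => mul_inv_cancel₀ (hp t ht)⟩, rfl⟩

lemma inverse_harmMean (hA : IsStrictlyPositive A) (hB : IsStrictlyPositive B) {μ : ℝ}
    (hμ₀ : 0 ≤ μ) (hμ₁ : μ ≤ 1) :
    Ring.inverse (harmMean μ A B) = invPerspective (fun t => 1 - μ + μ * t⁻¹) A B := by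
  rw [harmMean, ← invPerspective_add_mul_inv hA hB]
  exact Ring.inverse_inverse (isUnit_invPerspective_add_mul_inv hA hB hμ₀ hμ₁)

end Perspective

/-! ### Comparison of the quadratic forms -/

section Comparison

open ContinuousLinearMap
open scoped InnerProductSpace

variable {H : Type*} [NormedAddCommGroup H] [InnerProductSpace ℂ H]

lemma reApplyInnerSelf_mono {S T : H →L[ℂ] H} (h : S ≤ T) (x : H) :
    S.reApplyInnerSelf x ≤ T.reApplyInnerSelf x := by
  have h1 := ((ContinuousLinearMap.le_def S T).1 h).re_inner_nonneg_left x
  rw [sub_apply, inner_sub_left, map_sub] at h1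
  rw [reApplyInnerSelf_apply, reApplyInnerSelf_apply]
  linarith

lemma reApplyInnerSelf_smul_one (r : ℝ) (x : H) :
    (r • (1 : H →L[ℂ] H)).reApplyInnerSelf x = r * ‖x‖ ^ 2 := by
  rw [reApplyInnerSelf_apply, smul_apply, inner_smul_left_eq_smul, RCLike.smul_re]
  exact congrArg (r * ·) (inner_self_eq_norm_sq (𝕜 := ℂ) x)

lemma inverse_smul_one {r : ℝ} (hr : r ≠ 0) :
    Ring.inverse (r • (1 : H →L[ℂ] H)) = r⁻¹ • (1 : H →L[ℂ] H) :=
  Ring.inverse_unit ⟨r • (1 : H →L[ℂ] H), r⁻¹ • (1 : H →L[ℂ] H),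
    by rw [smul_mul_smul_comm, mul_inv_cancel₀ hr, one_smul, mul_one],
    by rw [smul_mul_smul_comm, inv_mul_cancel₀ hr, one_smul, mul_one]⟩

variable [CompleteSpace H] {A B : H →L[ℂ] H} {f : ℝ → ℝ} {c s : ℝ}

lemma isStrictlyPositive_smul_one {r : ℝ} (hr : 0 < r) :
    IsStrictlyPositive (r • (1 : H →L[ℂ] H)) :=
  isStrictlyPositive_one.smul hr

lemma norm_apply_le_of_le_smul_one {T : H →L[ℂ] H} (hT : 0 ≤ T) {r : ℝ} (hr : 0 ≤ r)
    (h : T ≤ r • (1 : H →L[ℂ] H)) (x : H) : ‖T x‖ ≤ r * ‖x‖ := by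
  refine (T.le_opNorm x).trans (mul_le_mul_of_nonneg_right ?_ (norm_nonneg x))
  refine (CStarAlgebra.norm_le_norm_of_nonneg_of_le hT h).trans ?_
  refine (norm_smul_le r _).trans ?_
  rw [Real.norm_of_nonneg hr]
  exact mul_le_of_le_one_right hr norm_id_le

lemma perspective_sub_one (hA : IsStrictlyPositive A) (hB : IsStrictlyPositive B) :
    perspective (fun t => t - 1) A B = B - A := by
  have h := perspective_affine hA hB (-1) 1
  rw [neg_one_smul, one_smul, neg_add_eq_sub] at h
  rw [← h]
  congr 1
  ext t
  ring

lemma CubicallySandwiched.nonneg (h : CubicallySandwiched c s f) (hc : 0 ≤ c) (hs₀ : 0 ≤ s)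
    (hs₁ : s ≤ 1) {t : ℝ} (ht : 0 < t) : 0 ≤ f t := by
  have hq := one_sub_add_mul_pos hs₀ hs₁ ht
  exact le_trans (by positivity) (h t ht).1

lemma CubicallySandwiched.apply_one (h : CubicallySandwiched c s f) : f 1 = 0 := by
  have := h 1 one_pos
  simpa using le_antisymm (this.2.trans_eq (by simp)) (le_trans (by simp) this.1)

/-- If the perspective of `w` is `W` and `D = B - A`, then `c W D W D W` is the perspective of
`c (t - 1)² w(t)³`. -/
lemma invPerspective_cube (hA : IsStrictlyPositive A) (hB : IsStrictlyPositive B) {w : ℝ → ℝ}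
    (hw : ContinuousOn w (Set.Ioi 0)) (c : ℝ) :
    invPerspective (fun t => c * (t - 1) ^ 2 * w t ^ 3) A B =
      c • (invPerspective w A B * (B - A) * invPerspective w A B * (B - A) *
        invPerspective w A B) := by
  have hd : ContinuousOn (fun t : ℝ => t - 1) (Set.Ioi 0) := by fun_prop
  have hs := spectrum_relQuotient_subset hA hB
  rw [← perspective_sub_one hA hB, invPerspective_mul_perspective_mul_invPerspective hA hB hw hd hw,
    invPerspective_mul_perspective_mul_invPerspective hA hB (f := fun t => w t * (t - 1) * w t)
      ((hw.mul hd).mul hw) hd hw,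
    invPerspective, invPerspective, ← smul_mul_assoc, ← mul_smul_comm, 
    ← cfc_const_mul c (fun t => w t * (t - 1) * w t * (t - 1) * w t) _
    (((((hw.mul hd).mul hw).mul hd).mul hw).mono hs)]
  congr 3
  ext t
  ring

lemma isSelfAdjoint_sub (hA : IsStrictlyPositive A) (hB : IsStrictlyPositive B) :
    IsSelfAdjoint (B - A) :=
  (IsSelfAdjoint.of_nonneg hB.nonneg).sub (.of_nonneg hA.nonneg)

lemma IsSelfAdjoint.inner_apply_left {T : H →L[ℂ] H} (hT : IsSelfAdjoint T) (x y : H) :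
    ⟪T x, y⟫_ℂ = ⟪x, T y⟫_ℂ :=
  hT.isSymmetric x y

lemma arithMean_le {K : H →L[ℂ] H} (hA : A ≤ K) (hB : B ≤ K) (hs₀ : 0 ≤ s) (hs₁ : s ≤ 1) :
    arithMean s A B ≤ K :=
  calc arithMean s A B ≤ (1 - s) • K + s • K :=
        add_le_add (smul_le_smul_of_nonneg_left hA (by linarith))
          (smul_le_smul_of_nonneg_left hB hs₀)
    _ = K := by rw [← add_smul, sub_add_cancel, one_smul]

lemma isStrictlyPositive_arithMean (hA : IsStrictlyPositive A) (hB : IsStrictlyPositive B)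
    (hs₀ : 0 ≤ s) (hs₁ : s ≤ 1) : IsStrictlyPositive (arithMean s A B) := by
  refine ⟨add_nonneg (smul_nonneg (by linarith) hA.nonneg) (smul_nonneg hs₀ hB.nonneg), ?_⟩
  have hq : ∀ t : ℝ, 0 < t → (1 - s + s * t)⁻¹ * (1 - s + s * t) = 1 := fun t ht =>
    inv_mul_cancel₀ (one_sub_add_mul_pos hs₀ hs₁ ht).ne'
  have hw := continuousOn_inv_affine hs₀ hs₁
  rw [arithMean, ← perspective_affine hA hB]
  exact ⟨⟨_, _, perspective_mul_invPerspective_eq_one hA hB hw (by fun_prop) hq,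
    invPerspective_mul_perspective_eq_one hA hB hw (by fun_prop) hq⟩, rfl⟩

/-- The lower bound for operators below `1/2`. With `M = (1 - s) A + s B ≤ 1/2` and `D = B - A`
the perspective of `f` is at least `c M⁻¹ D M⁻¹ D M⁻¹`, and `M⁻¹ ≥ 2`. -/
lemma le_reApplyInnerSelf_invPerspective (hA : IsStrictlyPositive A) (hB : IsStrictlyPositive B)
    (hA_le : A ≤ (1 / 2 : ℝ) • (1 : H →L[ℂ] H)) (hB_le : B ≤ (1 / 2 : ℝ) • (1 : H →L[ℂ] H))
    (hf : ContinuousOn f (Set.Ioi 0)) (h : CubicallySandwiched c s f) (hc : 0 ≤ c) (hs₀ : 0 ≤ s)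
    (hs₁ : s ≤ 1) (v : H) :
    2 * c * ‖(B - A) v‖ ^ 2 ≤ (invPerspective f A B).reApplyInnerSelf (arithMean s A B v) := by
  have hq : ∀ t : ℝ, 0 < t → 1 - s + s * t ≠ 0 := fun t ht => (one_sub_add_mul_pos hs₀ hs₁ ht).ne'
  have hw := continuousOn_inv_affine hs₀ hs₁
  have hM : arithMean s A B = perspective (fun t => 1 - s + s * t) A B :=
    (perspective_affine hA hB (1 - s) s).symm
  set Z := invPerspective (fun t => (1 - s + s * t)⁻¹) A B with hZ
  set D := B - A with hD
  have hZM : Z * arithMean s A B = 1 := by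
    rw [hM]
    exact invPerspective_mul_perspective_eq_one hA hB hw (by fun_prop)
      fun t ht => inv_mul_cancel₀ (hq t ht)
  have hZ0 : 0 ≤ Z := invPerspective_nonneg hA hB fun t ht =>
    (inv_pos.2 (one_sub_add_mul_pos hs₀ hs₁ ht)).le
  have hZsa : IsSelfAdjoint Z := .of_nonneg hZ0
  have hDsa : IsSelfAdjoint D := isSelfAdjoint_sub hA hB
  -- the lower half of the sandwich, read off through `invPerspective_cube`
  have hle : c • (Z * D * Z * D * Z) ≤ invPerspective f A B := by
    rw [hZ, hD, ← invPerspective_cube hA hB hw c]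
    refine invPerspective_mono hA hB (by fun_prop) hf fun t ht => ?_
    refine le_of_eq_of_le ?_ (h t ht).1
    rw [div_eq_mul_inv, inv_pow]
  have hM_le := arithMean_le hA_le hB_le hs₀ hs₁
  have hZ2 : (2 : ℝ) • (1 : H →L[ℂ] H) ≤ Z := by
    have h1 := CStarAlgebra.ringInverse_le_ringInverse hM_le
      (isStrictlyPositive_arithMean hA hB hs₀ hs₁)
    rwa [inverse_smul_one (by norm_num), one_div, inv_inv, inverse_arithMean hA hB hs₀ hs₁] at h1
  have hZMv : Z (arithMean s A B v) = v := by
    rw [← mul_apply_eq_comp, hZM, one_apply_eq_self]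
  have key : (c • (Z * D * Z * D * Z)).reApplyInnerSelf (arithMean s A B v) =
      c * Z.reApplyInnerSelf (D v) := by
    rw [reApplyInnerSelf_apply, reApplyInnerSelf_apply, smul_apply, inner_smul_left_eq_smul,
      RCLike.smul_re]
    simp only [mul_apply_eq_comp, hZMv]
    rw [hZsa.inner_apply_left, hZMv, hDsa.inner_apply_left]
  calc 2 * c * ‖D v‖ ^ 2 = c * ((2 : ℝ) • (1 : H →L[ℂ] H)).reApplyInnerSelf (D v) := by
        rw [reApplyInnerSelf_smul_one]; ring
    _ ≤ c * Z.reApplyInnerSelf (D v) :=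
        mul_le_mul_of_nonneg_left (reApplyInnerSelf_mono hZ2 _) hc
    _ ≤ _ := key.symm.trans_le (reApplyInnerSelf_mono hle _)

/-- The upper bound for operators above `1/2`. With `W = (1 - s) A⁻¹ + s B⁻¹ ≤ 2` and `D = B - A`
the perspective of `f` is at most `c W D W D W`. -/
lemma reApplyInnerSelf_invPerspective_le (hA : IsStrictlyPositive A) (hB : IsStrictlyPositive B)
    (hf : ContinuousOn f (Set.Ioi 0)) (h : CubicallySandwiched c s f) (hc : 0 ≤ c) (hs₀ : 0 ≤ s)
    (hs₁ : s ≤ 1)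
    (hW : invPerspective (fun t => 1 - s + s * t⁻¹) A B ≤ (2 : ℝ) • (1 : H →L[ℂ] H)) (x : H) :
    (invPerspective f A B).reApplyInnerSelf x ≤
      2 * c * ‖(B - A) (invPerspective (fun t => 1 - s + s * t⁻¹) A B x)‖ ^ 2 := by
  have hw := continuousOn_add_mul_inv (1 - s) s
  have hle : invPerspective f A B ≤ c • (invPerspective (fun t => 1 - s + s * t⁻¹) A B * (B - A) *
      invPerspective (fun t => 1 - s + s * t⁻¹) A B * (B - A) *
        invPerspective (fun t => 1 - s + s * t⁻¹) A B) := by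
    rw [← invPerspective_cube hA hB hw c]
    exact invPerspective_mono hA hB hf (by fun_prop) fun t ht => (h t ht).2
  set W := invPerspective (fun t => 1 - s + s * t⁻¹) A B
  set D := B - A
  have hWsa : IsSelfAdjoint W := .of_nonneg (invPerspective_nonneg hA hB fun t ht =>
    (one_sub_add_mul_inv_pos hs₀ hs₁ ht).le)
  have hDsa : IsSelfAdjoint D := isSelfAdjoint_sub hA hB
  have key : (c • (W * D * W * D * W)).reApplyInnerSelf x =
      c * W.reApplyInnerSelf (D (W x)) := by
    rw [reApplyInnerSelf_apply, reApplyInnerSelf_apply, smul_apply, inner_smul_left_eq_smul,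
      RCLike.smul_re]
    simp only [mul_apply_eq_comp]
    rw [hWsa.inner_apply_left, hDsa.inner_apply_left]
  calc (invPerspective f A B).reApplyInnerSelf x ≤ c * W.reApplyInnerSelf (D (W x)) :=
        (reApplyInnerSelf_mono hle _).trans_eq key
    _ ≤ c * ((2 : ℝ) • (1 : H →L[ℂ] H)).reApplyInnerSelf (D (W x)) :=
        mul_le_mul_of_nonneg_left (reApplyInnerSelf_mono hW _) hc
    _ = 2 * c * ‖D (W x)‖ ^ 2 := by rw [reApplyInnerSelf_smul_one]; ring

lemma inverse_le_two (hA_ge : (1 / 2 : ℝ) • (1 : H →L[ℂ] H) ≤ A) :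
    Ring.inverse A ≤ (2 : ℝ) • (1 : H →L[ℂ] H) := by
  have h := CStarAlgebra.ringInverse_le_ringInverse hA_ge
    (isStrictlyPositive_smul_one (by norm_num))
  rwa [inverse_smul_one (by norm_num), one_div, inv_inv] at h

/-- Positivity and compactness of the perspective of a sandwiched function. -/
lemma isPositive_isCompactOperator_invPerspective (hA : IsStrictlyPositive A)
    (hB : IsStrictlyPositive B) (hAB : IsCompactOperator (A - B))
    (hf : ContinuousOn f (Set.Ioi 0)) (hfd : DifferentiableAt ℝ f 1)
    (h : CubicallySandwiched c s f) (hc : 0 ≤ c) (hs₀ : 0 ≤ s) (hs₁ : s ≤ 1) :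
    (invPerspective f A B).IsPositive ∧ IsCompactOperator (invPerspective f A B) :=
  ⟨(nonneg_iff_isPositive _).1 (invPerspective_nonneg hA hB fun _ ht => h.nonneg hc hs₀ hs₁ ht),
    isCompactOperator_invPerspective hA hB hf h.apply_one hfd hAB⟩

/-- For `A, B ≤ 1/2 ≤ A', B'` with `A' + A = B' + B`, the perspective of a sandwiched function at
`A', B'` has smaller eigenvalues than that at `A, B`, with equality throughout only if `A = B`. -/
theorem orderedEigenvalue_invPerspective_comparison {A' B' : H →L[ℂ] H}
    (hA : IsStrictlyPositive A) (hB : IsStrictlyPositive B)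
    (hA_le : A ≤ (1 / 2 : ℝ) • (1 : H →L[ℂ] H)) (hB_le : B ≤ (1 / 2 : ℝ) • (1 : H →L[ℂ] H))
    (hA'_ge : (1 / 2 : ℝ) • (1 : H →L[ℂ] H) ≤ A') (hB'_ge : (1 / 2 : ℝ) • (1 : H →L[ℂ] H) ≤ B')
    (hsum : A' + A = B' + B) (hAB : IsCompactOperator (A - B))
    (hf : ContinuousOn f (Set.Ioi 0)) (hfd : DifferentiableAt ℝ f 1)
    (h : CubicallySandwiched c s f) (hc : 0 ≤ c) (hs₀ : 0 ≤ s) (hs₁ : s ≤ 1) :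
    (∀ j : ℕ, 1 ≤ j → orderedEigenvalue (invPerspective f A' B') j ≤
      orderedEigenvalue (invPerspective f A B) j) ∧
    (0 < c → 0 < s → s < 1 → ((∀ j : ℕ, 1 ≤ j → orderedEigenvalue (invPerspective f A' B') j =
      orderedEigenvalue (invPerspective f A B) j) ↔ A = B)) := by
  have hhalf : IsStrictlyPositive ((1 / 2 : ℝ) • (1 : H →L[ℂ] H)) :=
    isStrictlyPositive_smul_one (by norm_num)
  have hA' : IsStrictlyPositive A' := hhalf.of_le hA'_ge
  have hB' : IsStrictlyPositive B' := hhalf.of_le hB'_ge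
  have hD' : B' - A' = -(B - A) := by
    rw [← sub_eq_zero, show B' - A' - -(B - A) = (B' + B) - (A' + A) by abel, hsum, sub_self]
  have hAB' : IsCompactOperator (A' - B') := by
    rw [show A' - B' = -(A - B) by rw [← neg_sub B' A', hD', neg_sub B A]]
    exact hAB.neg
  obtain ⟨hT, hTc⟩ := isPositive_isCompactOperator_invPerspective hA hB hAB hf hfd h hc hs₀ hs₁
  obtain ⟨hT', hTc'⟩ :=
    isPositive_isCompactOperator_invPerspective hA' hB' hAB' hf hfd h hc hs₀ hs₁
  set T := invPerspective f A B with hTdef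
  set T' := invPerspective f A' B' with hTdef'
  set W := invPerspective (fun t => 1 - s + s * t⁻¹) A' B' with hWdef
  have hWeq : W = (1 - s) • Ring.inverse A' + s • Ring.inverse B' :=
    invPerspective_add_mul_inv hA' hB' (1 - s) s
  have hW2 : W ≤ (2 : ℝ) • (1 : H →L[ℂ] H) := by
    rw [hWeq]
    exact arithMean_le (inverse_le_two hA'_ge) (inverse_le_two hB'_ge) hs₀ hs₁
  have hW0 : 0 ≤ W := invPerspective_nonneg hA' hB' fun t ht =>
    (one_sub_add_mul_inv_pos hs₀ hs₁ ht).le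
  have hWn : ∀ x, ‖W x‖ ≤ 2 * ‖x‖ := norm_apply_le_of_le_smul_one hW0 (by norm_num) hW2
  set M := arithMean s A B with hM
  have hMpos : IsStrictlyPositive M := isStrictlyPositive_arithMean hA hB hs₀ hs₁
  have hMn : ∀ x, ‖M x‖ ≤ 1 / 2 * ‖x‖ :=
    norm_apply_le_of_le_smul_one hMpos.nonneg (by norm_num) (arithMean_le hA_le hB_le hs₀ hs₁)
  have hlow : ∀ v, 2 * c * ‖(B - A) v‖ ^ 2 ≤ T.reApplyInnerSelf (M v) :=
    le_reApplyInnerSelf_invPerspective hA hB hA_le hB_le hf h hc hs₀ hs₁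
  have hup : ∀ x, T'.reApplyInnerSelf x ≤ 2 * c * ‖(B - A) (W x)‖ ^ 2 := by
    intro x
    have h1 := reApplyInnerSelf_invPerspective_le hA' hB' hf h hc hs₀ hs₁ hW2 x
    rwa [hD', neg_apply, norm_neg] at h1
  refine ⟨fun j hj => ?_, fun hc0 hs0 hs1 => ⟨fun heq => ?_, ?_⟩⟩
  · -- `M W` is a contraction that carries the form of `T'` to that of `T`, by the two bounds.
    have hinj : Function.Injective (M * W : H →L[ℂ] H) :=
      (ContinuousLinearMap.isUnit_iff_bijective.1
        (hMpos.isUnit.mul (isUnit_invPerspective_add_mul_inv hA' hB' hs₀ hs₁))).1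
    refine orderedEigenvalue_le_of_transport hT' hTc' hT hTc
      ((M * W : H →L[ℂ] H) : H →ₗ[ℂ] H) hinj (fun t ht x hx => ?_) hj
    have h1 : ‖M (W x)‖ ≤ ‖x‖ := by
      have := hMn (W x)
      have := hWn x
      linarith
    calc t * ‖M (W x)‖ ^ 2 ≤ t * ‖x‖ ^ 2 := by gcongr
      _ ≤ T'.reApplyInnerSelf x := hx
      _ ≤ 2 * c * ‖(B - A) (W x)‖ ^ 2 := hup x
      _ ≤ T.reApplyInnerSelf (M (W x)) := hlow _
  · -- Only the largest eigenvalues, which are the norms, are needed.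
    have hnorm : ‖T'‖ = ‖T‖ := by
      rw [← orderedEigenvalue_one hT' hTc', ← orderedEigenvalue_one hT hTc]
      exact heq 1 le_rfl
    have hDn : ∀ v, 2 * c * ‖(B - A) v‖ ^ 2 ≤ ‖T‖ / 4 * ‖v‖ ^ 2 := by
      intro v
      calc 2 * c * ‖(B - A) v‖ ^ 2 ≤ ‖T‖ * ‖M v‖ ^ 2 :=
            (hlow v).trans (reApplyInnerSelf_le_norm_mul_sq T _)
        _ ≤ ‖T‖ * (1 / 2 * ‖v‖) ^ 2 := by gcongr; exact hMn v
        _ = ‖T‖ / 4 * ‖v‖ ^ 2 := by ring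
    by_cases h0 : T' = 0
    · have hT0 : ‖T‖ = 0 := by rw [← hnorm, h0, norm_zero]
      refine (sub_eq_zero.1 (ContinuousLinearMap.ext fun v => ?_)).symm
      have h1 := hDn v
      rw [hT0, zero_div, zero_mul] at h1
      have h2 : ‖(B - A) v‖ ^ 2 ≤ 0 := nonpos_of_mul_nonpos_right h1 (by positivity)
      have h3 : ‖(B - A) v‖ = 0 := by
        rwa [sq_nonpos_iff] at h2
      exact norm_eq_zero.1 h3
    · exfalso
      obtain ⟨v, hv0, hv⟩ := exists_eigenvector_norm hT' hTc' h0
      have hvn : 0 < ‖v‖ := norm_pos_iff.2 hv0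
      have hTn : 0 < ‖T'‖ := norm_pos_iff.2 h0
      have hTv : T'.reApplyInnerSelf v = ‖T'‖ * ‖v‖ ^ 2 := by
        rw [reApplyInnerSelf_apply, hv, Complex.coe_smul, inner_smul_left_eq_smul, RCLike.smul_re,
          inner_self_eq_norm_sq]
      -- All the inequalities in the chain from `T'` to `T` are equalities at `v`.
      have hWv : 2 * ‖v‖ ≤ ‖W v‖ := by
        have h1 := (hup v).trans (hDn (W v))
        rw [hTv, hnorm] at h1
        rw [hnorm] at hTn
        refine le_of_sq_le_sq ?_ (norm_nonneg _)
        refine le_of_mul_le_mul_left ?_ hTn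
        linarith
      -- By strict convexity the two inverses agree at `v`, so that `B - A` annihilates `W v`.
      have hinv : Ring.inverse A' v = Ring.inverse B' v := by
        have : UniformConvexSpace H := by
          let _ := InnerProductSpace.rclikeToReal ℂ H
          exact InnerProductSpace.toUniformConvexSpace
        by_contra hne
        have hn : ∀ {K : H →L[ℂ] H}, (1 / 2 : ℝ) • (1 : H →L[ℂ] H) ≤ K →
            ‖Ring.inverse K v‖ ≤ 2 * ‖v‖ := fun {K} hK =>
          norm_apply_le_of_le_smul_one (hhalf.of_le hK).ringInverse.nonneg (by norm_num)
            (inverse_le_two hK) v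
        have h1 := norm_combo_lt_of_ne (hn hA'_ge) (hn hB'_ge) hne (sub_pos.2 hs1) hs0
          (sub_add_cancel 1 s)
        rw [hWeq] at hWv
        exact absurd hWv (not_le.2 h1)
      have hWa : W v = Ring.inverse A' v := by
        rw [hWeq]
        change (1 - s) • Ring.inverse A' v + s • Ring.inverse B' v = _
        rw [← hinv, ← add_smul, sub_add_cancel, one_smul]
      have hAv : A' (W v) = v := by
        rw [hWa, ← mul_apply_eq_comp, Ring.mul_inverse_cancel _ hA'.isUnit,
          one_apply_eq_self]
      have hBv : B' (W v) = v := by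
        rw [hWa, hinv, ← mul_apply_eq_comp, Ring.mul_inverse_cancel _ hB'.isUnit,
          one_apply_eq_self]
      have hzero : (B - A) (W v) = 0 := by
        rw [← neg_eq_zero, ← neg_apply, ← hD', sub_apply, hAv, hBv, sub_self]
      have h1 := hup v
      rw [hzero, norm_zero, hTv] at h1
      have h2 : 0 < ‖T'‖ * ‖v‖ ^ 2 := by positivity
      linarith
  · intro heq j _
    have h' : B' = A' := by rw [← sub_eq_zero, hD', heq, sub_self, neg_zero]
    rw [hTdef', hTdef, h', ← heq, invPerspective_self hA' h.apply_one,
      invPerspective_self hA h.apply_one]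

end Comparison

/-! ### The differences of the inverse means -/

lemma differentiableAt_rpow_one (p : ℝ) : DifferentiableAt ℝ (fun t : ℝ => t ^ p) 1 :=
  Real.differentiableAt_rpow_const_of_ne p one_ne_zero

lemma differentiableAt_inv_affine_one (μ : ℝ) :
    DifferentiableAt ℝ (fun t : ℝ => (1 - μ + μ * t)⁻¹) 1 :=
  DifferentiableAt.fun_inv (by fun_prop) (by simp)

lemma differentiableAt_add_mul_inv_one (μ : ℝ) :
    DifferentiableAt ℝ (fun t : ℝ => 1 - μ + μ * t⁻¹) 1 :=
  ((differentiableAt_inv one_ne_zero).const_mul μ).const_add _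

theorem mainTheorem9
    {H : Type*} [NormedAddCommGroup H] [InnerProductSpace ℂ H] [CompleteSpace H]
    [TopologicalSpace.SeparableSpace H]
    (μ : ℝ) (hμ₀ : 0 ≤ μ) (hμ₁ : μ ≤ 1)
    (A B A' B' : H →L[ℂ] H)
    (hA : IsStrictlyPositive A) (hB : IsStrictlyPositive B)
    (hA_le : A ≤ (1 / 2 : ℝ) • (1 : H →L[ℂ] H)) (hB_le : B ≤ (1 / 2 : ℝ) • (1 : H →L[ℂ] H))
    (hAB : IsCompactOperator (A - B))
    (hA' : A' = 1 - A) (hB' : B' = 1 - B)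
    (GA GA' HG HG' HA HA' : H →L[ℂ] H)
    (hGA : GA = Ring.inverse (geomMean μ A B) - Ring.inverse (arithMean μ A B))
    (hGA' : GA' = Ring.inverse (geomMean μ A' B') - Ring.inverse (arithMean μ A' B'))
    (hHG : HG = Ring.inverse (harmMean μ A B) - Ring.inverse (geomMean μ A B))
    (hHG' : HG' = Ring.inverse (harmMean μ A' B') - Ring.inverse (geomMean μ A' B'))
    (hHA : HA = Ring.inverse (harmMean μ A B) - Ring.inverse (arithMean μ A B))
    (hHA' : HA' = Ring.inverse (harmMean μ A' B') - Ring.inverse (arithMean μ A' B')) :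
    -- the six operators are positive and compact, so that their `λ_j` are meaningful
    ((GA.IsPositive ∧ IsCompactOperator GA) ∧ (GA'.IsPositive ∧ IsCompactOperator GA') ∧
      (HG.IsPositive ∧ IsCompactOperator HG) ∧ (HG'.IsPositive ∧ IsCompactOperator HG') ∧
      (HA.IsPositive ∧ IsCompactOperator HA) ∧ (HA'.IsPositive ∧ IsCompactOperator HA')) ∧
    -- the three systems of inequalities
    (∀ j : ℕ, 1 ≤ j → orderedEigenvalue GA' j ≤ orderedEigenvalue GA j) ∧
    (∀ j : ℕ, 1 ≤ j → orderedEigenvalue HG' j ≤ orderedEigenvalue HG j) ∧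
    (∀ j : ℕ, 1 ≤ j → orderedEigenvalue HA' j ≤ orderedEigenvalue HA j) ∧
    -- the equality cases
    (0 < μ → μ < 1 →
      ((∀ j : ℕ, 1 ≤ j → orderedEigenvalue GA' j = orderedEigenvalue GA j) ↔ A = B) ∧
      ((∀ j : ℕ, 1 ≤ j → orderedEigenvalue HG' j = orderedEigenvalue HG j) ↔ A = B) ∧
      ((∀ j : ℕ, 1 ≤ j → orderedEigenvalue HA' j = orderedEigenvalue HA j) ↔ A = B)) := by
  have hG := fun {X Y : H →L[ℂ] H} (hX : IsStrictlyPositive X) (hY : IsStrictlyPositive Y) =>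
    inverse_geomMean hX hY μ
  have hN := fun {X Y : H →L[ℂ] H} (hX : IsStrictlyPositive X) (hY : IsStrictlyPositive Y) =>
    inverse_arithMean hX hY hμ₀ hμ₁
  have hM := fun {X Y : H →L[ℂ] H} (hX : IsStrictlyPositive X) (hY : IsStrictlyPositive Y) =>
    inverse_harmMean hX hY hμ₀ hμ₁
  have hge : ∀ {X : H →L[ℂ] H}, X ≤ (1 / 2 : ℝ) • (1 : H →L[ℂ] H) →
      (1 / 2 : ℝ) • (1 : H →L[ℂ] H) ≤ 1 - X := by
    intro X hX
    refine le_trans (le_of_eq ?_) (sub_le_sub_left hX 1)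
    rw [eq_sub_iff_add_eq, ← add_smul, add_halves, one_smul]
  have hA'_ge := hge hA_le
  have hB'_ge := hge hB_le
  rw [← hA'] at hA'_ge
  rw [← hB'] at hB'_ge
  have hhalf : IsStrictlyPositive ((1 / 2 : ℝ) • (1 : H →L[ℂ] H)) :=
    isStrictlyPositive_smul_one (by norm_num)
  have hA'p := hhalf.of_le hA'_ge
  have hB'p := hhalf.of_le hB'_ge
  have hsum : A' + A = B' + B := by rw [hA', hB', sub_add_cancel, sub_add_cancel]
  have hAB' : IsCompactOperator (A' - B') := by
    rw [hA', hB', show 1 - A - (1 - B) = -(A - B) by abel]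
    exact hAB.neg
  have cr := continuousOn_rpow_Ioi (-μ)
  have ca := continuousOn_inv_affine hμ₀ hμ₁
  have ch := continuousOn_add_mul_inv (1 - μ) μ
  have dr := differentiableAt_rpow_one (-μ)
  have da := differentiableAt_inv_affine_one μ
  have dh := differentiableAt_add_mul_inv_one μ
  have sg := cubicallySandwiched_geom_sub_arith hμ₀ hμ₁
  have sh := cubicallySandwiched_harm_sub_geom hμ₀ hμ₁
  have sk := cubicallySandwiched_harm_sub_arith hμ₀ hμ₁
  have hν : 0 ≤ 1 - μ := by linarith
  have hc : 0 ≤ μ * (1 - μ) / 2 := by positivity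
  have hc' : 0 ≤ μ * (1 - μ) := by positivity
  rw [hG hA hB, hN hA hB, invPerspective_sub hA hB cr ca] at hGA
  rw [hG hA'p hB'p, hN hA'p hB'p, invPerspective_sub hA'p hB'p cr ca] at hGA'
  rw [hM hA hB, hG hA hB, invPerspective_sub hA hB ch cr] at hHG
  rw [hM hA'p hB'p, hG hA'p hB'p, invPerspective_sub hA'p hB'p ch cr] at hHG'
  rw [hM hA hB, hN hA hB, invPerspective_sub hA hB ch ca] at hHA
  rw [hM hA'p hB'p, hN hA'p hB'p, invPerspective_sub hA'p hB'p ch ca] at hHA'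
  rw [hGA, hGA', hHG, hHG', hHA, hHA']
  obtain ⟨g1, g2⟩ := orderedEigenvalue_invPerspective_comparison hA hB hA_le hB_le hA'_ge hB'_ge
    hsum hAB (cr.sub ca) (dr.sub da) sg hc (by linarith) (by linarith)
  obtain ⟨h1, h2⟩ := orderedEigenvalue_invPerspective_comparison hA hB hA_le hB_le hA'_ge hB'_ge
    hsum hAB (ch.sub cr) (dh.sub dr) sh hc (by linarith) (by linarith)
  obtain ⟨k1, k2⟩ := orderedEigenvalue_invPerspective_comparison hA hB hA_le hB_le hA'_ge hB'_ge
    hsum hAB (ch.sub ca) (dh.sub da) sk hc' (by linarith) (by linarith)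
  refine ⟨⟨?_, ?_, ?_, ?_, ?_, ?_⟩, g1, h1, k1, fun hμ₀' hμ₁' => ?_⟩
  · exact isPositive_isCompactOperator_invPerspective hA hB hAB (cr.sub ca) (dr.sub da) sg hc
      (by linarith) (by linarith)
  · exact isPositive_isCompactOperator_invPerspective hA'p hB'p hAB' (cr.sub ca) (dr.sub da) sg hc
      (by linarith) (by linarith)
  · exact isPositive_isCompactOperator_invPerspective hA hB hAB (ch.sub cr) (dh.sub dr) sh hc
      (by linarith) (by linarith)
  · exact isPositive_isCompactOperator_invPerspective hA'p hB'p hAB' (ch.sub cr) (dh.sub dr) sh hc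
      (by linarith) (by linarith)
  · exact isPositive_isCompactOperator_invPerspective hA hB hAB (ch.sub ca) (dh.sub da) sk hc'
      (by linarith) (by linarith)
  · exact isPositive_isCompactOperator_invPerspective hA'p hB'p hAB' (ch.sub ca) (dh.sub da) sk hc'
      (by linarith) (by linarith)
  · have hν' : 0 < 1 - μ := by linarith
    have hc0 : 0 < μ * (1 - μ) := by positivity
    exact ⟨g2 (by linarith) (by linarith) (by linarith),
      h2 (by linarith) (by linarith) (by linarith), k2 hc0 (by linarith) (by linarith)⟩
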